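/- Consider the following random graph process. It starts from the graph with a single vertex. At each step, two (not necessarily different) old vertices $u$ and $v$ are selected independently and uniformly at random, independently of the selections in all other steps; a new vertex is added and joined to $u$ and to all neighbours of $u$; after that, all edges incident to $v$ are deleted, without exception (including an edge between $v$ and the new vertex, if there is one). Thus there are $n+1$ vertices after $n$ steps. Then the graph is, after every step, a disjoint union of cliques (each of its connected components is a complete graph). Let $Y[n,k]$ denote the number of these cliques (connected components) of size $k$ after $n$ steps. There is a (deterministic) sequence $(y_k)_{k\ge 1}$ of positive real numbers satisfying \[ y_1=\frac{1+2y_2}{3},\qquad y_k=\frac{(k-1)y_{k-1}+(k+1)y_{k+1}}{2k+1}\quad (k\ge 2), \] such that for every positive integer $k$ \[ \frac{Y[n,k]}{n}\to y_k\quad\text{almost surely as } n\to\infty . \] -/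

import Mathlib

open MeasureTheory ProbabilityTheory Filter Topology
open scoped ENNReal

/-- Duplication of the vertex `u`: the old graph lives on the vertices `0, …, n - 1`; the new vertex
`Fin.last n` is joined to `u` and to all neighbours of `u`. -/
def duplicateVertex {n : ℕ} (G : SimpleGraph (Fin n)) (u : Fin n) : SimpleGraph (Fin (n + 1)) :=
  G.map Fin.castSucc ⊔
    SimpleGraph.fromRel fun a b =>
      a = Fin.last n ∧ ∃ w : Fin n, b = w.castSucc ∧ (w = u ∨ G.Adj u w)

/-- One step: the vertex `u` is duplicated, and then all edges at the old vertex `v` are deleted,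
including a possible edge from `v` to the new vertex. -/
def dupDelStep {n : ℕ} (G : SimpleGraph (Fin n)) (u v : Fin n) : SimpleGraph (Fin (n + 1)) :=
  (duplicateVertex G u).deleteIncidenceSet v.castSucc

/-- The graph after `n` steps (on `n + 1` vertices), started from a single vertex, where
`c n 0` and `c n 1` are the old vertices selected in step `n + 1` for duplication and for
deletion, respectively. -/
def dupDelGraph (c : (n : ℕ) → Fin 2 → Fin (n + 1)) : (n : ℕ) → SimpleGraph (Fin (n + 1))
  | 0 => ⊥
  | n + 1 => dupDelStep (dupDelGraph c n) (c n 0) (c n 1)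

/-- A graph is a disjoint union of cliques if each of its connected components is a clique. -/
def IsDisjointUnionOfCliques {V : Type*} (G : SimpleGraph V) : Prop :=
  ∀ K : G.ConnectedComponent, G.IsClique K.supp

/-- The number of connected components of `G` that are cliques on exactly `k` vertices. -/
noncomputable def numCliques {V : Type*} (G : SimpleGraph V) (k : ℕ) : ℕ :=
  {K : G.ConnectedComponent | G.IsClique K.supp ∧ K.supp.ncard = k}.ncard

/-- The selections are random: for each `n` the two vertices selected in step `n + 1` are uniformly
distributed on the `n + 1` old vertices, and all selections (within a step and over all steps) are
independent. -/
structure IsUniformSelection {Ω : Type*} [MeasurableSpace Ω] (μ : Measure Ω)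
    (C : (n : ℕ) → Fin 2 → Ω → Fin (n + 1)) : Prop where
  measurable : ∀ n i, Measurable (C n i)
  uniform : ∀ n i (a : Fin (n + 1)), μ {ω | C n i ω = a} = 1 / ((n : ℝ≥0∞) + 1)
  indep : iIndepFun (fun p : ℕ × Fin 2 => C p.1 p.2) μ

open scoped BigOperators

/-!
Count vertices instead of cliques: let `X k` be the number of vertices in cliques of size `k` and
let `X 0` be the number of all vertices. When there are `n` vertices, a clique of size `k` grows and
shrinks by one vertex with the same probability `k / n`, up to `O(1 / n ^ 2)`, so the mean change
of `X k` is `k * (X (k - 1) + X (k + 1) - 2 * X k) / n` up to `O(1 / n)`; the isolated vertex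
created in every step makes this true for `k = 1`. The remaining changes are bounded and orthogonal,
hence their averages vanish almost surely, and the rest of the argument is deterministic.

The fixed point of the mean dynamics is an explicit positive bounded sequence. The deviation `d k`
from it satisfies the same linear recursion with `d 0 = 0`. Let `D k` be the upper limit of
`|d k| / n`. As the diagonal coefficient of the recursion is negative,
`(1 + 2 * k) * D k ≤ k * (D (k - 1) + D (k + 1))`, so `D` is convex. Being bounded, it is
antitone, and `D 0 = 0`.
-/

/-- The density in `t` whose integral over `(0, ∞)` is `limitProfile k`. The critical linear
birth-death process started at `1` is at `k` at time `t` with probability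
`t ^ (k - 1) / (1 + t) ^ (k + 1)`, and `exp (-t)` is the density of the age of a clique. -/
noncomputable def profileDensity (k : ℕ) (t : ℝ) : ℝ :=
  Real.exp (-t) * (t / (1 + t)) ^ k

/-- The limiting fraction of vertices that lie in cliques of size `k`, for `k ≥ 1`. The value at `0`
is `1`, as for `vertexProfile`. -/
noncomputable def limitProfile (k : ℕ) : ℝ :=
  ∫ t in Set.Ioi (0 : ℝ), profileDensity k t

lemma profileDensity_pos (k : ℕ) {t : ℝ} (ht : 0 < t) : 0 < profileDensity k t := by
  unfold profileDensity
  positivity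

lemma profileDensity_le_exp_neg (k : ℕ) {t : ℝ} (ht : 0 ≤ t) :
    profileDensity k t ≤ Real.exp (-t) := by
  refine mul_le_of_le_one_right (Real.exp_nonneg _) (pow_le_one₀ (by positivity) ?_)
  exact div_le_one_of_le₀ (by linarith) (by positivity)

lemma integrableOn_profileDensity (k : ℕ) : IntegrableOn (profileDensity k) (Set.Ioi 0) := by
  refine (integrableOn_exp_neg_Ioi 0).mono' ?_ ?_
  · unfold profileDensity
    fun_prop
  · filter_upwards [ae_restrict_mem measurableSet_Ioi] with t ht
    rw [Real.norm_of_nonneg (profileDensity_pos k ht).le]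
    exact profileDensity_le_exp_neg k (Set.mem_Ioi.1 ht).le

lemma tendsto_profileDensity_atTop (k : ℕ) : Tendsto (profileDensity k) atTop (𝓝 0) := by
  refine squeeze_zero' ?_ ?_ Real.tendsto_exp_neg_atTop_nhds_zero
  · filter_upwards [eventually_gt_atTop 0] with t ht using (profileDensity_pos k ht).le
  · filter_upwards [eventually_ge_atTop 0] with t ht using profileDensity_le_exp_neg k ht

-- `s = t / (1 + t)` satisfies `s' = (1 - s) ^ 2`.
lemma hasDerivAt_profileDensity_succ (k : ℕ) {t : ℝ} (ht : 0 ≤ t) :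
    HasDerivAt (profileDensity (k + 1))
      ((k + 1) * (profileDensity k t + profileDensity (k + 2) t - 2 * profileDensity (k + 1) t) -
        profileDensity (k + 1) t) t := by
  have hs : HasDerivAt (fun t : ℝ => t / (1 + t)) ((1 - t / (1 + t)) ^ 2) t :=
    ((hasDerivAt_id' t).fun_div ((hasDerivAt_id' t).const_add 1) (by positivity)).congr_deriv (by
      field_simp
      ring)
  refine ((hasDerivAt_neg' t).exp.fun_mul (hs.fun_pow (k + 1))).congr_deriv ?_
  simp only [profileDensity, Nat.cast_add, Nat.cast_one, Nat.add_sub_cancel]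
  ring

lemma limitProfile_zero : limitProfile 0 = 1 := by
  simp only [limitProfile, profileDensity, pow_zero, mul_one, integral_exp_neg_Ioi_zero]

lemma limitProfile_pos (k : ℕ) : 0 < limitProfile k := by
  have hpos : ∀ t ∈ Set.Ioi (0 : ℝ), 0 < profileDensity k t := fun t ht => profileDensity_pos k ht
  refine (setIntegral_pos_iff_support_of_nonneg_ae ?_ (integrableOn_profileDensity k)).2 ?_
  · filter_upwards [ae_restrict_mem measurableSet_Ioi] with t ht using (hpos t ht).le
  · have hsupp : Set.Ioi (0 : ℝ) ⊆ Function.support (profileDensity k) :=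
      fun t ht => (hpos t ht).ne'
    rw [Set.inter_eq_right.2 hsupp, Real.volume_Ioi]
    exact ENNReal.zero_lt_top

lemma limitProfile_le_one (k : ℕ) : limitProfile k ≤ 1 := by
  rw [← integral_exp_neg_Ioi_zero]
  exact setIntegral_mono_on (integrableOn_profileDensity k) (integrableOn_exp_neg_Ioi 0)
    measurableSet_Ioi fun t ht => profileDensity_le_exp_neg k (Set.mem_Ioi.1 ht).le

lemma limitProfile_succ (k : ℕ) :
    limitProfile (k + 1) =
      (k + 1) * (limitProfile k + limitProfile (k + 2) - 2 * limitProfile (k + 1)) := by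
  have hint := integrableOn_profileDensity
  have hadd : IntegrableOn (fun t => profileDensity k t + profileDensity (k + 2) t) (Set.Ioi 0) :=
    (hint k).add (hint (k + 2))
  have hsub : IntegrableOn (fun t =>
      profileDensity k t + profileDensity (k + 2) t - 2 * profileDensity (k + 1) t) (Set.Ioi 0) :=
    hadd.sub ((hint (k + 1)).const_mul 2)
  have hftc := integral_Ioi_of_hasDerivAt_of_tendsto'
    (fun t ht => hasDerivAt_profileDensity_succ k (Set.mem_Ici.1 ht))
    ((hsub.const_mul _).sub (hint (k + 1))) (tendsto_profileDensity_atTop (k + 1))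
  have hzero : profileDensity (k + 1) 0 = 0 := by simp [profileDensity]
  rw [integral_sub (hsub.const_mul _) (hint (k + 1)), integral_const_mul,
    integral_sub hadd ((hint (k + 1)).const_mul 2), integral_add (hint k) (hint (k + 2)),
    integral_const_mul, hzero, sub_zero] at hftc
  exact (sub_eq_zero.1 hftc).symm

lemma exists_eventually_le_of_recursive_le {w : ℕ → ℝ} {c B : ℝ} (hc : 0 ≤ c)
    (hw : ∀ᶠ n : ℕ in atTop, w (n + 1) ≤ (1 - c / (n + 1)) * w n + B) :
    ∃ A, ∀ᶠ n : ℕ in atTop, w n ≤ B / (1 + c) * (n + 1) + A := by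
  obtain ⟨N, hN⟩ := eventually_atTop.1
    (hw.and (tendsto_natCast_atTop_atTop.eventually_ge_atTop c))
  set β := B / (1 + c) with hβ
  have hβB : B = β * (1 + c) := by rw [hβ]; field_simp
  refine ⟨max (w N - β * (N + 1)) 0, eventually_atTop.2 ⟨N, fun n hn => ?_⟩⟩
  set A := max (w N - β * (N + 1)) 0
  induction n, hn using Nat.le_induction with
  | base => linarith [le_max_left (w N - β * (N + 1)) 0]
  | succ n hn ih =>
    obtain ⟨hrec, hcn⟩ := hN n hn
    have hq : 0 ≤ 1 - c / ((n : ℝ) + 1) := by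
      rw [sub_nonneg, div_le_one (by positivity)]
      linarith
    have hA : 0 ≤ c / ((n : ℝ) + 1) * A := mul_nonneg (by positivity) (le_max_right _ _)
    calc w (n + 1) ≤ (1 - c / (n + 1)) * w n + B := hrec
      _ ≤ (1 - c / (n + 1)) * (β * (n + 1) + A) + B := by gcongr
      _ = β * ((n + 1 : ℕ) + 1) + A - c / (n + 1) * A := by
        rw [hβB]
        push_cast
        field_simp
        ring
      _ ≤ β * ((n + 1 : ℕ) + 1) + A := by linarith

lemma eventually_abs_div_le_of_recursion {v b : ℕ → ℝ} {c B : ℝ} (hc : 0 ≤ c)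
    (hv : ∀ n : ℕ, v (n + 1) = (1 - c / (n + 1)) * v n + b n)
    (hb : ∀ ε > 0, ∀ᶠ n in atTop, |b n| ≤ B + ε) {ε : ℝ} (hε : 0 < ε) :
    ∀ᶠ n : ℕ in atTop, |v n| / (n + 1) ≤ B / (1 + c) + ε := by
  obtain ⟨δ, hδ, hδε⟩ : ∃ δ > 0, δ / (1 + c) + δ = ε :=
    ⟨ε * (1 + c) / (2 + c), by positivity, by field_simp; ring⟩
  have habs : ∀ᶠ n : ℕ in atTop, |v (n + 1)| ≤ (1 - c / (n + 1)) * |v n| + (B + δ) := by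
    filter_upwards [hb δ hδ, tendsto_natCast_atTop_atTop.eventually_ge_atTop c] with n hbn hcn
    have hq : 0 ≤ 1 - c / ((n : ℝ) + 1) := by
      rw [sub_nonneg, div_le_one (by positivity)]
      linarith
    calc |v (n + 1)| ≤ |(1 - c / (n + 1)) * v n| + |b n| := hv n ▸ abs_add_le _ _
      _ ≤ (1 - c / (n + 1)) * |v n| + (B + δ) := by
        rw [abs_mul, abs_of_nonneg hq]
        gcongr
  obtain ⟨A, hA⟩ := exists_eventually_le_of_recursive_le (w := fun n => |v n|) hc habs
  filter_upwards [hA, tendsto_natCast_atTop_atTop.eventually_ge_atTop (A / δ)] with n hvn hAn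
  rw [div_le_iff₀ hδ] at hAn
  rw [add_div] at hvn
  rw [div_le_iff₀ (by positivity), ← hδε]
  linarith

lemma abs_div_add_one (x : ℝ) (n : ℕ) : |x / (n + 1)| = |x| / (n + 1) := by
  rw [abs_div, abs_of_pos (by positivity : (0 : ℝ) < n + 1)]

lemma tendsto_div_succ_of_tendsto_div {u : ℕ → ℝ} {a : ℝ}
    (hu : Tendsto (fun n : ℕ => u n / n) atTop (𝓝 a)) :
    Tendsto (fun n : ℕ => u n / (n + 1)) atTop (𝓝 a) := by
  have hmul := hu.mul (tendsto_natCast_div_add_atTop (1 : ℝ))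
  rw [mul_one] at hmul
  refine hmul.congr' ?_
  filter_upwards [eventually_ne_atTop 0] with n hn
  field_simp

-- Subtracting the partial sums of `ξ` turns the noise into a negligible change of `b`.
lemma eventually_abs_div_le_of_noisy_recursion {u b ξ : ℕ → ℝ} {c B : ℝ} (hc : 0 ≤ c)
    (hu : ∀ n : ℕ, u (n + 1) = (1 - c / (n + 1)) * u n + b n + ξ n)
    (hb : ∀ ε > 0, ∀ᶠ n in atTop, |b n| ≤ B + ε)
    (hξ : Tendsto (fun n : ℕ => (∑ m ∈ Finset.range n, ξ m) / n) atTop (𝓝 0))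
    {ε : ℝ} (hε : 0 < ε) :
    ∀ᶠ n : ℕ in atTop, |u n| / (n + 1) ≤ B / (1 + c) + ε := by
  set M : ℕ → ℝ := fun n => ∑ m ∈ Finset.range n, ξ m
  have hM : Tendsto (fun n : ℕ => |M n / (n + 1)|) atTop (𝓝 0) := by
    simpa only [abs_zero] using (tendsto_div_succ_of_tendsto_div hξ).abs
  have hrec : ∀ n : ℕ, u (n + 1) - M (n + 1) =
      (1 - c / (n + 1)) * (u n - M n) + (b n - c * (M n / (n + 1))) := fun n => by
    rw [hu n, show M (n + 1) = M n + ξ n from Finset.sum_range_succ ξ n]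
    ring
  have hb' : ∀ δ > 0, ∀ᶠ n : ℕ in atTop, |b n - c * (M n / (n + 1))| ≤ B + δ := fun δ hδ => by
    have hcM := hM.const_mul c
    rw [mul_zero] at hcM
    filter_upwards [hb (δ / 2) (half_pos hδ), hcM.eventually_le_const (half_pos hδ)]
      with n hbn hcMn
    calc |b n - c * (M n / (n + 1))| ≤ |b n| + |c * (M n / (n + 1))| := abs_sub _ _
      _ ≤ B + δ := by
        rw [abs_mul, abs_of_nonneg hc]
        linarith
  filter_upwards [eventually_abs_div_le_of_recursion (v := fun n => u n - M n) hc hrec hb'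
    (half_pos hε), hM.eventually_le_const (half_pos hε)] with n hn hMn
  calc |u n| / (n + 1) = |(u n - M n) / (n + 1) + M n / (n + 1)| := by
        rw [← add_div, sub_add_cancel, abs_div_add_one]
    _ ≤ |u n - M n| / (n + 1) + |M n / (n + 1)| := by
        rw [← abs_div_add_one]
        exact abs_add_le _ _
    _ ≤ B / (1 + c) + ε := by linarith

lemma antitone_of_midpoint_convex_of_bddAbove {E : ℕ → ℝ} (hbdd : BddAbove (Set.range E))
    (hconv : ∀ k, 2 * E (k + 1) ≤ E k + E (k + 2)) : Antitone E := by
  refine antitone_nat_of_succ_le fun k => ?_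
  by_contra! hlt
  have hslope : ∀ j, E (k + 1) - E k ≤ E (k + j + 1) - E (k + j) := fun j => by
    induction j with
    | zero => rfl
    | succ j ih =>
      rw [← add_assoc]
      linarith [hconv (k + j)]
  have hgrow : ∀ j : ℕ, j * (E (k + 1) - E k) ≤ E (k + j) - E k := fun j => by
    induction j with
    | zero => simp
    | succ j ih =>
      rw [← add_assoc]
      push_cast
      linarith [hslope j]
  obtain ⟨C, hC⟩ := hbdd
  obtain ⟨j, hj⟩ := exists_nat_gt ((C - E k) / (E (k + 1) - E k))
  rw [div_lt_iff₀ (sub_pos.2 hlt)] at hj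
  linarith [hgrow j, hC ⟨k + j, rfl⟩]

/-- The upper limit of `|v n| / (n + 1)`. It is a junk value unless `v` grows at most linearly. -/
noncomputable def growthRate (v : ℕ → ℝ) : ℝ :=
  limsup (fun n : ℕ => |v n| / ((n : ℝ) + 1)) atTop

section GrowthRate

variable {v : ℕ → ℝ} {a B ε : ℝ}

lemma growthRate_le_of_eventually (h : ∀ᶠ n : ℕ in atTop, |v n| / (n + 1) ≤ a) :
    growthRate v ≤ a :=
  limsup_le_of_le (isBoundedUnder_of (r := (· ≥ ·))
    ⟨0, fun n => by positivity⟩).isCoboundedUnder_le h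

lemma isBoundedUnder_abs_div (hv : ∀ n, |v n| ≤ B * (n + 1)) :
    IsBoundedUnder (· ≤ ·) atTop fun n : ℕ => |v n| / ((n : ℝ) + 1) :=
  isBoundedUnder_of ⟨B, fun n => (div_le_iff₀ (by positivity)).2 (hv n)⟩

lemma growthRate_nonneg (hv : ∀ n, |v n| ≤ B * (n + 1)) : 0 ≤ growthRate v :=
  le_limsup_of_frequently_le (Frequently.of_forall fun n => by positivity)
    (isBoundedUnder_abs_div hv)

lemma eventually_lt_growthRate_add (hv : ∀ n, |v n| ≤ B * (n + 1)) (hε : 0 < ε) :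
    ∀ᶠ n : ℕ in atTop, |v n| / (n + 1) < growthRate v + ε :=
  eventually_lt_of_limsup_lt (lt_add_of_pos_right _ hε) (isBoundedUnder_abs_div hv)

lemma growthRate_eq_zero_of_tendsto (hv : Tendsto (fun n : ℕ => v n / (n + 1)) atTop (𝓝 0)) :
    growthRate v = 0 := by
  simpa only [growthRate, abs_div_add_one, abs_zero] using hv.abs.limsup_eq

lemma tendsto_div_of_growthRate_le_zero (hv : ∀ n, |v n| ≤ B * (n + 1))
    (hrate : growthRate v ≤ 0) : Tendsto (fun n : ℕ => v n / (n + 1)) atTop (𝓝 0) := by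
  rw [tendsto_zero_iff_abs_tendsto_zero]
  refine tendsto_order.2
    ⟨fun a ha => .of_forall fun n => ha.trans_le (abs_nonneg _), fun ε hε => ?_⟩
  filter_upwards [eventually_lt_growthRate_add hv hε] with n hn
  rw [Function.comp_apply, abs_div_add_one]
  linarith

lemma growthRate_le_of_diffusion {v₀ v₂ ξ : ℕ → ℝ} {c : ℝ} (hc : 0 ≤ c)
    (hv₀ : ∀ n, |v₀ n| ≤ B * (n + 1)) (hv₂ : ∀ n, |v₂ n| ≤ B * (n + 1))
    (hv : ∀ n, v (n + 1) = v n + c * (v₀ n + v₂ n - 2 * v n) / (n + 1) + ξ n)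
    (hξ : Tendsto (fun n : ℕ => (∑ m ∈ Finset.range n, ξ m) / n) atTop (𝓝 0)) :
    growthRate v ≤ c * (growthRate v₀ + growthRate v₂) / (1 + 2 * c) := by
  refine le_of_forall_pos_le_add fun ε hε => growthRate_le_of_eventually ?_
  refine eventually_abs_div_le_of_noisy_recursion (b := fun n => c * ((v₀ n + v₂ n) / (n + 1)))
    (by positivity) (fun n => by rw [hv]; ring) (fun δ hδ => ?_) hξ hε
  obtain ⟨η, hη, hηδ⟩ : ∃ η > 0, c * (2 * η) ≤ δ :=
    ⟨δ / (2 * (1 + c)), by positivity, by field_simp; linarith⟩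
  filter_upwards [eventually_lt_growthRate_add hv₀ hη, eventually_lt_growthRate_add hv₂ hη]
    with n hn₀ hn₂
  calc |c * ((v₀ n + v₂ n) / (n + 1))| ≤ c * (|v₀ n| / (n + 1) + |v₂ n| / (n + 1)) := by
        rw [abs_mul, abs_of_nonneg hc, abs_div_add_one, ← add_div]
        gcongr
        exact abs_add_le _ _
    _ ≤ c * ((growthRate v₀ + η) + (growthRate v₂ + η)) := by gcongr
    _ ≤ c * (growthRate v₀ + growthRate v₂) + δ := by linarith

end GrowthRate

-- The growth rates of the `d k` are a bounded convex function of `k`, hence antitone.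
lemma tendsto_div_zero_of_diffusive_recursion {d ξ : ℕ → ℕ → ℝ} {c : ℕ → ℝ} {B : ℝ}
    (hc : ∀ k, 0 ≤ c k) (hB : ∀ k n, |d k n| ≤ B * (n + 1))
    (hd0 : Tendsto (fun n : ℕ => d 0 n / (n + 1)) atTop (𝓝 0))
    (hd : ∀ k n, d (k + 1) (n + 1) =
      d (k + 1) n + c k * (d k n + d (k + 2) n - 2 * d (k + 1) n) / (n + 1) + ξ k n)
    (hξ : ∀ k, Tendsto (fun n : ℕ => (∑ m ∈ Finset.range n, ξ k m) / n) atTop (𝓝 0)) (k : ℕ) :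
    Tendsto (fun n : ℕ => d k n / (n + 1)) atTop (𝓝 0) := by
  have hbdd : BddAbove (Set.range fun k => growthRate (d k)) :=
    ⟨B, Set.forall_mem_range.2 fun k => growthRate_le_of_eventually <| .of_forall fun n =>
      (div_le_iff₀ (by positivity)).2 (hB k n)⟩
  have hconv : ∀ k, 2 * growthRate (d (k + 1)) ≤ growthRate (d k) + growthRate (d (k + 2)) := by
    intro k
    have hck := hc k
    have hsum := add_nonneg (growthRate_nonneg (hB k)) (growthRate_nonneg (hB (k + 2)))
    have hhalf : c k * (growthRate (d k) + growthRate (d (k + 2))) / (1 + 2 * c k) ≤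
        (growthRate (d k) + growthRate (d (k + 2))) / 2 := by
      rw [div_le_iff₀ (by positivity)]
      linarith
    linarith [growthRate_le_of_diffusion hck (hB k) (hB (k + 2)) (hd k) (hξ k)]
  refine tendsto_div_of_growthRate_le_zero (hB k) ?_
  calc growthRate (d k) ≤ growthRate (d 0) :=
        antitone_of_midpoint_convex_of_bddAbove hbdd hconv (Nat.zero_le k)
    _ = 0 := growthRate_eq_zero_of_tendsto hd0

lemma eventually_succ_sq_le_mul_sq {a : ℝ} (ha : 1 < a) :
    ∀ᶠ n : ℕ in atTop, (((n + 1) ^ 2 : ℕ) : ℝ) ≤ a * ((n ^ 2 : ℕ) : ℝ) := by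
  have hlim : Tendsto (fun n : ℕ => ((n / (n + 1) : ℝ)) ^ 2) atTop (𝓝 1) := by
    simpa using (tendsto_natCast_div_add_atTop (1 : ℝ)).pow 2
  filter_upwards [hlim.eventually_const_le (inv_lt_one_of_one_lt₀ ha)] with n hn
  rw [div_pow, le_div_iff₀ (by positivity), inv_mul_le_iff₀ (by positivity)] at hn
  exact_mod_cast hn

lemma tendsto_sum_div_of_tendsto_sum_sq_div {x : ℕ → ℝ} {B : ℝ} (hx : ∀ n, -B ≤ x n)
    (hsq : Tendsto (fun n : ℕ => (∑ m ∈ Finset.range (n ^ 2), x m) / ((n ^ 2 : ℕ) : ℝ))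
      atTop (𝓝 0)) :
    Tendsto (fun n : ℕ => (∑ m ∈ Finset.range n, x m) / n) atTop (𝓝 0) := by
  have hshift : ∀ᶠ n : ℕ in atTop, (∑ m ∈ Finset.range n, (x m + B)) / n =
      (∑ m ∈ Finset.range n, x m) / n + B := by
    filter_upwards [eventually_ne_atTop 0] with n hn
    rw [Finset.sum_add_distrib, Finset.sum_const, Finset.card_range, nsmul_eq_mul]
    field_simp
  have hpow : Tendsto (fun n : ℕ => n ^ 2) atTop atTop := tendsto_pow_atTop two_ne_zero
  have hmono : Monotone fun n => ∑ m ∈ Finset.range n, (x m + B) :=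
    monotone_nat_of_le_succ fun n => by
      rw [Finset.sum_range_succ]
      linarith [hx n]
  have hlim := tendsto_div_of_monotone_of_exists_subseq_tendsto_div _ B hmono fun a ha =>
    ⟨fun n => n ^ 2, eventually_succ_sq_le_mul_sq ha, hpow, by
      have hsqB := hsq.add_const B
      rw [zero_add] at hsqB
      exact hsqB.congr' ((hpow.eventually hshift).mono fun n hn => hn.symm)⟩
  have hsub := (hlim.congr' hshift).sub_const B
  simpa only [add_sub_cancel_right, sub_self] using hsub

section Orthogonal

variable {Ω : Type*} [MeasurableSpace Ω] {μ : Measure Ω}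

lemma ae_tendsto_zero_of_integral_sq_le {f : ℕ → Ω → ℝ} {a : ℕ → ℝ}
    (hf : ∀ n, MemLp (f n) 2 μ) (ha : Summable a) (hfa : ∀ n, ∫ ω, f n ω ^ 2 ∂μ ≤ a n) :
    ∀ᵐ ω ∂μ, Tendsto (fun n => f n ω) atTop (𝓝 0) := by
  have hnorm : ∀ n, eLpNorm (fun ω => f n ω ^ 2) 1 μ ≤ ENNReal.ofReal (a n) := fun n => by
    rw [eLpNorm_one_eq_lintegral_enorm, ← ofReal_integral_norm_eq_lintegral_enorm
      (hf n).integrable_sq]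
    simp only [norm_pow, Real.norm_eq_abs, sq_abs]
    exact ENNReal.ofReal_le_ofReal (hfa n)
  have hsum := summable_norm_of_tsum_eLpNorm_ne_top le_rfl
    (fun n => (hf n).integrable_sq.aestronglyMeasurable)
    (ne_top_of_le_ne_top ha.tsum_ofReal_ne_top (ENNReal.tsum_le_tsum hnorm))
  filter_upwards [hsum] with ω hω
  have hsqrt := hω.tendsto_atTop_zero.sqrt
  simp only [norm_pow, Real.norm_eq_abs, Real.sqrt_sq (abs_nonneg _), Real.sqrt_zero] at hsqrt
  exact (tendsto_zero_iff_abs_tendsto_zero _).2 hsqrt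

lemma integral_sum_sq_of_orthogonal {ι : Type*} {ξ : ι → Ω → ℝ} (hξ : ∀ i, MemLp (ξ i) 2 μ)
    (horth : Pairwise fun i j => ∫ ω, ξ i ω * ξ j ω ∂μ = 0) (s : Finset ι) :
    ∫ ω, (∑ i ∈ s, ξ i ω) ^ 2 ∂μ = ∑ i ∈ s, ∫ ω, ξ i ω ^ 2 ∂μ := by
  have hint : ∀ i j, Integrable (fun ω => ξ i ω * ξ j ω) μ := fun i j =>
    (hξ i).integrable_mul (hξ j)
  simp_rw [sq, Finset.sum_mul_sum]
  rw [integral_finsetSum _ fun i _ => integrable_finsetSum _ fun j _ => hint i j]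
  refine Finset.sum_congr rfl fun i hi => ?_
  rw [integral_finsetSum _ fun j _ => hint i j, Finset.sum_eq_single_of_mem i hi]
  exact fun j _ hji => horth hji.symm

lemma ae_tendsto_sum_div_of_orthogonal {ξ : ℕ → Ω → ℝ} {B K : ℝ} (hξ : ∀ n, MemLp (ξ n) 2 μ)
    (hK : ∀ n, ∫ ω, ξ n ω ^ 2 ∂μ ≤ K) (hB : ∀ n, ∀ᵐ ω ∂μ, -B ≤ ξ n ω)
    (horth : Pairwise fun i j => ∫ ω, ξ i ω * ξ j ω ∂μ = 0) :
    ∀ᵐ ω ∂μ, Tendsto (fun n : ℕ => (∑ m ∈ Finset.range n, ξ m ω) / n) atTop (𝓝 0) := by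
  have hmem : ∀ n : ℕ,
      MemLp (fun ω => (∑ m ∈ Finset.range (n ^ 2), ξ m ω) / ((n ^ 2 : ℕ) : ℝ)) 2 μ := fun n => by
    simpa only [div_eq_inv_mul] using (memLp_finsetSum _ fun m _ => hξ m).const_mul _
  have hsecond : ∀ n : ℕ, ∫ ω, ((∑ m ∈ Finset.range (n ^ 2), ξ m ω) / ((n ^ 2 : ℕ) : ℝ)) ^ 2 ∂μ ≤
      K * (1 / (n : ℝ) ^ 2) := fun n => by
    simp_rw [div_pow]
    rw [integral_div, integral_sum_sq_of_orthogonal hξ horth]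
    have hsum := Finset.sum_le_card_nsmul (Finset.range (n ^ 2)) _ K fun m _ => hK m
    rw [Finset.card_range, nsmul_eq_mul] at hsum
    rcases eq_or_ne n 0 with rfl | hn
    · simp
    · rw [div_le_iff₀ (by positivity)]
      refine hsum.trans_eq ?_
      push_cast
      field_simp
  filter_upwards [ae_tendsto_zero_of_integral_sq_le hmem
    ((Real.summable_one_div_nat_pow.2 one_lt_two).mul_left K) hsecond, ae_all_iff.2 hB]
    with ω hω hBω using tendsto_sum_div_of_tendsto_sum_sq_div hBω hω

end Orthogonal

lemma integral_comp_eq_zero_of_indepFun {Ω α β : Type*} [MeasurableSpace Ω] [MeasurableSpace α]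
    [MeasurableSpace β] {μ : Measure Ω} [IsFiniteMeasure μ] {X : Ω → α} {Z : Ω → β}
    (hX : AEMeasurable X μ) (hZ : AEMeasurable Z μ) (hXZ : IndepFun X Z μ) {f : α × β → ℝ}
    (hf : Measurable f) (hf0 : ∀ x, ∫ ω, f (x, Z ω) ∂μ = 0) :
    ∫ ω, f (X ω, Z ω) ∂μ = 0 := by
  have hsection : ∀ x, ∫ z, f (x, z) ∂μ.map Z = 0 := fun x =>
    (integral_map hZ (hf.comp measurable_prodMk_left).aestronglyMeasurable).trans (hf0 x)
  rw [← integral_map (hX.prodMk hZ) hf.aestronglyMeasurable,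
    (indepFun_iff_map_prod_eq_prod_map_map hX hZ).1 hXZ]
  by_cases hint : Integrable f ((μ.map X).prod (μ.map Z))
  · rw [integral_prod f hint, integral_eq_zero_of_ae (.of_forall hsection)]
  · exact integral_undef hint

/-- The σ-algebra generated by the selections indexed by `S`, where `(n, i)` stands for the `i`-th
selection of step `n + 1`. -/
@[reducible]
def selectionSigma {Ω : Type*} (C : (n : ℕ) → Fin 2 → Ω → Fin (n + 1)) (S : Set (ℕ × Fin 2)) :
    MeasurableSpace Ω :=
  ⨆ p ∈ S, MeasurableSpace.comap (C p.1 p.2) ⊤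

instance {V : Type*} : MeasurableSpace (SimpleGraph V) := ⊤

section Selection

variable {Ω : Type*} {C : (n : ℕ) → Fin 2 → Ω → Fin (n + 1)}

lemma measurable_selection {S : Set (ℕ × Fin 2)} {n : ℕ} {i : Fin 2} (hS : (n, i) ∈ S) :
    Measurable[selectionSigma C S] (C n i) :=
  measurable_iff_comap_le.2 (le_iSup₂_of_le (n, i) hS le_rfl)

lemma measurable_dupDelGraph {m j : ℕ} (hmj : m ≤ j) :
    Measurable[selectionSigma C {p | p.1 < j}] fun ω => dupDelGraph (fun n i => C n i ω) m := by
  induction m with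
  | zero => exact measurable_const
  | succ m ih =>
    have hstep : Measurable fun q : SimpleGraph (Fin (m + 1)) × Fin (m + 1) × Fin (m + 1) =>
        dupDelStep q.1 q.2.1 q.2.2 := .of_discrete
    have hsel : ∀ i, Measurable[selectionSigma C {p | p.1 < j}] (C m i) := fun i =>
      measurable_selection (Nat.lt_of_succ_le hmj)
    exact hstep.comp ((ih (Nat.le_of_succ_le hmj)).prodMk ((hsel 0).prodMk (hsel 1)))

end Selection

namespace IsUniformSelection

variable {Ω : Type*} [MeasurableSpace Ω] {μ : Measure Ω}
  {C : (n : ℕ) → Fin 2 → Ω → Fin (n + 1)} (hC : IsUniformSelection μ C)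
include hC

lemma selectionSigma_le (S : Set (ℕ × Fin 2)) : selectionSigma C S ≤ ‹MeasurableSpace Ω› :=
  iSup₂_le fun p _ => (hC.measurable p.1 p.2).comap_le

lemma measurable_pair (j : ℕ) : Measurable fun ω => (C j 0 ω, C j 1 ω) :=
  (hC.measurable j 0).prodMk (hC.measurable j 1)

lemma indepFun_of_disjoint {α β : Type*} [MeasurableSpace α] [MeasurableSpace β]
    {S T : Set (ℕ × Fin 2)} (hST : Disjoint S T) {X : Ω → α} {Z : Ω → β}
    (hX : Measurable[selectionSigma C S] X) (hZ : Measurable[selectionSigma C T] Z) :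
    IndepFun X Z μ := by
  have hindep : Indep (selectionSigma C S) (selectionSigma C T) μ :=
    indep_iSup_of_disjoint (m := fun p : ℕ × Fin 2 => MeasurableSpace.comap (C p.1 p.2) ⊤)
      (fun p => (hC.measurable p.1 p.2).comap_le) hC.indep hST
  rw [IndepFun_iff_Indep]
  exact indep_of_indep_of_le_left (indep_of_indep_of_le_right hindep hZ.comap_le) hX.comap_le

lemma indepFun_pair {α : Type*} [MeasurableSpace α] {j : ℕ} {X : Ω → α}
    (hX : Measurable[selectionSigma C {p | p.1 < j}] X) :
    IndepFun X (fun ω => (C j 0 ω, C j 1 ω)) μ := by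
  have hdisj : Disjoint {p : ℕ × Fin 2 | p.1 < j} {p | p.1 = j} :=
    Set.disjoint_left.2 fun _ hp hp' => hp.ne hp'
  have hsel : ∀ i, Measurable[selectionSigma C {p | p.1 = j}] (C j i) := fun i =>
    measurable_selection rfl
  exact hC.indepFun_of_disjoint hdisj hX ((hsel 0).prodMk (hsel 1))

lemma measureReal_singleton (n : ℕ) (i : Fin 2) (a : Fin (n + 1)) :
    (μ.map (C n i)).real {a} = ((n : ℝ) + 1)⁻¹ := by
  have huniform : μ (C n i ⁻¹' {a}) = 1 / ((n : ℝ≥0∞) + 1) := hC.uniform n i a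
  rw [map_measureReal_apply (hC.measurable n i) (measurableSet_singleton a), measureReal_def,
    huniform, one_div, ENNReal.toReal_inv]
  norm_cast

lemma integral_pair [IsProbabilityMeasure μ] {j : ℕ} (f : Fin (j + 1) × Fin (j + 1) → ℝ) :
    ∫ ω, f (C j 0 ω, C j 1 ω) ∂μ = 𝔼 p, f p := by
  have hindep : IndepFun (C j 0) (C j 1) μ :=
    hC.indep.indepFun (i := (j, 0)) (j := (j, 1)) (by simp)
  have hmap := (indepFun_iff_map_prod_eq_prod_map_map (hC.measurable j 0).aemeasurable
    (hC.measurable j 1).aemeasurable).1 hindep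
  have hpoint : ∀ p : Fin (j + 1) × Fin (j + 1),
      (μ.map fun ω => (C j 0 ω, C j 1 ω)).real {p} =
        (Fintype.card (Fin (j + 1) × Fin (j + 1)) : ℝ)⁻¹ := fun p => by
    rw [hmap, ← Set.singleton_prod_singleton (a := p.1), measureReal_prod_prod,
      hC.measureReal_singleton, hC.measureReal_singleton, Fintype.card_prod, Fintype.card_fin]
    push_cast
    rw [mul_inv]
  rw [← integral_map (hC.measurable_pair j).aemeasurable (by fun_prop),
    integral_fintype .of_finite, Fintype.expect_eq_sum_div_card]
  simp_rw [hpoint, smul_eq_mul, ← Finset.mul_sum, div_eq_inv_mul]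

end IsUniformSelection

section ClosedNeighborhood

variable {V : Type*} [Fintype V] {G : SimpleGraph V} {a b c : V}

open scoped Classical in
/-- The closed neighbourhood of `a`, which is its clique if `G` is a disjoint union of cliques. -/
noncomputable def closedNeighborFinset (G : SimpleGraph V) (a : V) : Finset V :=
  {b | b = a ∨ G.Adj a b}

/-- The number of vertices equal or adjacent to `a`. -/
noncomputable def closedDegree (G : SimpleGraph V) (a : V) : ℕ :=
  (closedNeighborFinset G a).card

lemma mem_closedNeighborFinset : b ∈ closedNeighborFinset G a ↔ b = a ∨ G.Adj a b := by
  simp only [closedNeighborFinset, Finset.mem_filter_univ]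

lemma self_mem_closedNeighborFinset (G : SimpleGraph V) (a : V) : a ∈ closedNeighborFinset G a :=
  mem_closedNeighborFinset.2 (.inl rfl)

lemma mem_closedNeighborFinset_comm :
    b ∈ closedNeighborFinset G a ↔ a ∈ closedNeighborFinset G b := by
  simp only [mem_closedNeighborFinset, eq_comm, G.adj_comm]

lemma closedDegree_pos (G : SimpleGraph V) (a : V) : 0 < closedDegree G a :=
  Finset.card_pos.2 ⟨a, self_mem_closedNeighborFinset G a⟩

lemma isDisjointUnionOfCliques_of_mem_trans
    (htrans : ∀ a b c, b ∈ closedNeighborFinset G a → c ∈ closedNeighborFinset G b →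
      c ∈ closedNeighborFinset G a) : IsDisjointUnionOfCliques G := by
  have hreach : ∀ a b, G.Reachable a b → b ∈ closedNeighborFinset G a := by
    rintro a b ⟨p⟩
    induction p with
    | nil => exact self_mem_closedNeighborFinset G _
    | cons hadj _ ih => exact htrans _ _ _ (mem_closedNeighborFinset.2 (.inr hadj)) ih
  intro K a ha b hb hab
  have hab' := SimpleGraph.ConnectedComponent.exact (ha.trans hb.symm)
  exact (mem_closedNeighborFinset.1 (hreach a b hab')).resolve_left hab.symm

namespace IsDisjointUnionOfCliques

variable (hG : IsDisjointUnionOfCliques G)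
include hG

lemma reachable_iff : G.Reachable a b ↔ b ∈ closedNeighborFinset G a := by
  rw [mem_closedNeighborFinset]
  refine ⟨fun hab => or_iff_not_imp_left.2 fun hne => ?_, ?_⟩
  · exact hG (G.connectedComponentMk a) rfl
      (SimpleGraph.ConnectedComponent.sound hab.symm) (Ne.symm hne)
  · rintro (rfl | hadj)
    exacts [.rfl, hadj.reachable]

lemma mem_trans (hb : b ∈ closedNeighborFinset G a) (hc : c ∈ closedNeighborFinset G b) :
    c ∈ closedNeighborFinset G a :=
  hG.reachable_iff.1 ((hG.reachable_iff.2 hb).trans (hG.reachable_iff.2 hc))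

lemma supp_connectedComponentMk (a : V) :
    (G.connectedComponentMk a).supp = closedNeighborFinset G a := by
  ext b
  rw [SimpleGraph.ConnectedComponent.mem_supp_iff, SimpleGraph.ConnectedComponent.eq,
    SimpleGraph.reachable_comm, hG.reachable_iff, Finset.mem_coe]

lemma ncard_supp (a : V) : (G.connectedComponentMk a).supp.ncard = closedDegree G a := by
  rw [hG.supp_connectedComponentMk, Set.ncard_coe_finset, closedDegree]

lemma closedDegree_eq (hb : b ∈ closedNeighborFinset G a) :
    closedDegree G b = closedDegree G a := by
  rw [← hG.ncard_supp, ← hG.ncard_supp,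
    SimpleGraph.ConnectedComponent.sound (hG.reachable_iff.2 hb)]

lemma card_filter_closedDegree_le (a : V) (m : ℕ) :
    ({b ∈ closedNeighborFinset G a | closedDegree G b ≤ m} : Finset V).card ≤ m := by
  by_cases ha : closedDegree G a ≤ m
  · exact (Finset.card_filter_le _ _).trans ha
  · rw [Finset.filter_false_of_mem fun b hb => hG.closedDegree_eq hb ▸ ha, Finset.card_empty]
    exact Nat.zero_le m

lemma numCliques_mul (k : ℕ) :
    numCliques G k * k = ({a | closedDegree G a = k} : Finset V).card := by
  classical
  have := Fintype.ofFinite G.ConnectedComponent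
  have hcliques : numCliques G k =
      ({K | K.supp.ncard = k} : Finset G.ConnectedComponent).card := by
    rw [numCliques, ← Set.ncard_coe_finset]
    congr
    ext K
    simp [hG K]
  have hfiber : ∀ K : G.ConnectedComponent, K.supp.ncard = k →
      ({a ∈ ({a | closedDegree G a = k} : Finset V) | G.connectedComponentMk a = K} :
        Finset V).card = k := by
    rintro K rfl
    rw [← Set.ncard_coe_finset]
    congr
    ext a
    simp only [Finset.coe_filter, Finset.mem_filter_univ, Set.mem_ofPred_eq,
      SimpleGraph.ConnectedComponent.mem_supp_iff, and_iff_right_iff_imp]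
    rintro rfl
    exact (hG.ncard_supp a).symm
  rw [hcliques, Finset.card_eq_sum_card_fiberwise (f := G.connectedComponentMk)
    (t := {K | K.supp.ncard = k}), Finset.sum_const_nat fun K hK =>
      hfiber K (Finset.mem_filter_univ K |>.1 hK)]
  intro a ha
  simpa [hG.ncard_supp] using ha

end IsDisjointUnionOfCliques

/-- For `k ≥ 1`, the number of vertices of closed degree `k`. The value at `0` is the number of all
vertices: since every step creates one isolated vertex, the formula for the mean change of
`vertexProfile G (k + 1)` then has the same form for `k = 0` as for `k ≥ 1`. -/
noncomputable def vertexProfile (G : SimpleGraph V) : ℕ → ℕ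
  | 0 => Fintype.card V
  | k + 1 => ({a | closedDegree G a = k + 1} : Finset V).card

lemma vertexProfile_le_card (G : SimpleGraph V) : ∀ k, vertexProfile G k ≤ Fintype.card V
  | 0 => le_rfl
  | _ + 1 => Finset.card_le_univ _

lemma IsDisjointUnionOfCliques.vertexProfile_eq (hG : IsDisjointUnionOfCliques G) {k : ℕ}
    (hk : 1 ≤ k) : vertexProfile G k = numCliques G k * k := by
  obtain ⟨k, rfl⟩ := Nat.exists_eq_add_of_le' hk
  exact (hG.numCliques_mul (k + 1)).symm

end ClosedNeighborhood

section Step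

variable {n : ℕ} {G : SimpleGraph (Fin n)} {u v : Fin n} {x y : Fin (n + 1)}

/-- The old vertex of which a vertex is a copy when `u` is duplicated. -/
def copiedVertex (u : Fin n) : Fin (n + 1) → Fin n :=
  Fin.lastCases u id

@[simp]
lemma copiedVertex_castSucc (u w : Fin n) : copiedVertex u w.castSucc = w :=
  Fin.lastCases_castSucc ..

@[simp]
lemma copiedVertex_last (u : Fin n) : copiedVertex u (Fin.last n) = u :=
  Fin.lastCases_last ..

lemma duplicateVertex_adj :
    (duplicateVertex G u).Adj x y ↔
      x ≠ y ∧ copiedVertex u y ∈ closedNeighborFinset G (copiedVertex u x) := by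
  rw [duplicateVertex, SimpleGraph.sup_adj, SimpleGraph.fromRel_adj, mem_closedNeighborFinset,
    eq_comm (a := copiedVertex u y)]
  cases x using Fin.lastCases <;> cases y using Fin.lastCases <;>
    simp +contextual [SimpleGraph.map_adj', Fin.castSucc_ne_last, (Fin.castSucc_ne_last _).symm,
      eq_comm (b := u), G.adj_comm _ u]

lemma mem_closedNeighborFinset_dupDelStep :
    y ∈ closedNeighborFinset (dupDelStep G u v) x ↔ y = x ∨
      (x ≠ v.castSucc ∧ y ≠ v.castSucc ∧
        copiedVertex u y ∈ closedNeighborFinset G (copiedVertex u x)) := by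
  rw [mem_closedNeighborFinset, dupDelStep, SimpleGraph.deleteIncidenceSet_adj, duplicateVertex_adj]
  tauto

lemma isDisjointUnionOfCliques_dupDelStep (hG : IsDisjointUnionOfCliques G) (u v : Fin n) :
    IsDisjointUnionOfCliques (dupDelStep G u v) := by
  refine isDisjointUnionOfCliques_of_mem_trans fun x y z hy hz => ?_
  rw [mem_closedNeighborFinset_dupDelStep] at hy hz ⊢
  rcases hy with rfl | ⟨hxv, hyv, hxy⟩
  · exact hz
  · rcases hz with rfl | ⟨-, hzv, hyz⟩
    · exact .inr ⟨hxv, hyv, hxy⟩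
    · exact .inr ⟨hxv, hzv, hG.mem_trans hxy hyz⟩

lemma isDisjointUnionOfCliques_dupDelGraph (c : (n : ℕ) → Fin 2 → Fin (n + 1)) :
    ∀ n, IsDisjointUnionOfCliques (dupDelGraph c n)
  | 0 => isDisjointUnionOfCliques_of_mem_trans (by simp [mem_closedNeighborFinset, dupDelGraph])
  | n + 1 => isDisjointUnionOfCliques_dupDelStep (isDisjointUnionOfCliques_dupDelGraph c n) _ _

lemma closedDegree_dupDelStep_deleted (G : SimpleGraph (Fin n)) (u v : Fin n) :
    closedDegree (dupDelStep G u v) v.castSucc = 1 := by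
  rw [closedDegree, Finset.card_eq_one]
  exact ⟨v.castSucc, by ext; simp [mem_closedNeighborFinset_dupDelStep]⟩

open scoped Classical in
lemma closedDegree_dupDelStep_add (G : SimpleGraph (Fin n)) (u : Fin n) (hx : x ≠ v.castSucc) :
    closedDegree (dupDelStep G u v) x +
        (if v ∈ closedNeighborFinset G (copiedVertex u x) then 1 else 0) =
      closedDegree G (copiedVertex u x) +
        (if u ∈ closedNeighborFinset G (copiedVertex u x) then 1 else 0) := by
  set N := closedNeighborFinset G (copiedVertex u x)
  have hmem : ∀ y, y ∈ closedNeighborFinset (dupDelStep G u v) x ↔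
      y ≠ v.castSucc ∧ copiedVertex u y ∈ N := fun y => by
    rw [mem_closedNeighborFinset_dupDelStep]
    constructor
    · rintro (rfl | ⟨-, hy⟩)
      exacts [⟨hx, self_mem_closedNeighborFinset G _⟩, hy]
    · exact fun hy => .inr ⟨hx, hy⟩
  have herase : closedNeighborFinset (dupDelStep G u v) x =
      ({y | copiedVertex u y ∈ N} : Finset (Fin (n + 1))).erase v.castSucc := by
    ext y
    rw [hmem, Finset.mem_erase, Finset.mem_filter_univ]
  have hcard : ({y | copiedVertex u y ∈ N} : Finset (Fin (n + 1))).card =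
      N.card + if u ∈ N then 1 else 0 := by
    rw [Finset.card_filter, Fin.sum_univ_castSucc]
    simp
  rw [closedDegree, closedDegree, ← hcard, herase]
  split_ifs with hv
  · exact Finset.card_erase_add_one (by simpa using hv)
  · rw [Finset.erase_eq_of_notMem (by simpa using hv), add_zero]

end Step

section Drift

lemma sum_ite_mem_eq_card_mul_add {V : Type*} [Fintype V] [DecidableEq V] (s : Finset V)
    (a b : ℝ) :
    ∑ w, (if w ∈ s then a else b) = s.card * a + (Fintype.card V - s.card) * b := by
  rw [Finset.sum_ite, Finset.sum_const, Finset.sum_const, nsmul_eq_mul, nsmul_eq_mul,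
    Finset.filter_univ_mem, Finset.filter_not, Finset.filter_univ_mem,
    Finset.cast_card_sdiff (Finset.subset_univ s), Finset.card_univ]

lemma vertexProfile_succ_eq_sum {V : Type*} [Fintype V] (G : SimpleGraph V) (k : ℕ) :
    (vertexProfile G (k + 1) : ℝ) = ∑ a, if closedDegree G a = k + 1 then 1 else 0 := by
  rw [Finset.sum_boole, vertexProfile]

lemma sum_mul_ite_closedDegree_eq {V : Type*} [Fintype V] (G : SimpleGraph V) (f : ℕ → ℝ) (k : ℕ) :
    ∑ a, f (closedDegree G a) * (if closedDegree G a = k + 1 then 1 else 0) =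
      f (k + 1) * vertexProfile G (k + 1) := by
  rw [vertexProfile_succ_eq_sum, Finset.mul_sum]
  refine Finset.sum_congr rfl fun a _ => ?_
  split_ifs with h
  · rw [h]
  · simp only [mul_zero]

variable {n : ℕ} (G : SimpleGraph (Fin n))

open scoped Classical in
lemma closedDegree_dupDelStep_of_ne {u v : Fin n} {x : Fin (n + 1)} (hx : x ≠ v.castSucc) :
    closedDegree (dupDelStep G u v) x = closedDegree G (copiedVertex u x) +
      (if u ∈ closedNeighborFinset G (copiedVertex u x) then 1 else 0) -
      (if v ∈ closedNeighborFinset G (copiedVertex u x) then 1 else 0) :=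
  Nat.eq_sub_of_add_eq (closedDegree_dupDelStep_add G u hx)

open scoped Classical in
lemma sum_closedDegree_dupDelStep_castSucc (φ : ℕ → ℝ) (u w : Fin n) :
    ∑ v, φ (closedDegree (dupDelStep G u v) w.castSucc) =
      φ 1 + if u ∈ closedNeighborFinset G w then
        (closedDegree G w - 1) * φ (closedDegree G w) +
          (n - closedDegree G w) * φ (closedDegree G w + 1)
      else
        (closedDegree G w - 1) * φ (closedDegree G w - 1) +
          (n - closedDegree G w) * φ (closedDegree G w) := by
  set t := if u ∈ closedNeighborFinset G w then 1 else 0 with ht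
  have hterm : ∀ v, φ (closedDegree (dupDelStep G u v) w.castSucc) =
      (if v ∈ closedNeighborFinset G w then φ (closedDegree G w + t - 1)
        else φ (closedDegree G w + t)) +
      if v = w then φ 1 - φ (closedDegree G w + t - 1) else 0 := by
    intro v
    by_cases hvw : v = w
    · subst hvw
      simp [closedDegree_dupDelStep_deleted, self_mem_closedNeighborFinset]
    · have hne : w.castSucc ≠ v.castSucc := fun h => hvw (Fin.castSucc_injective n h).symm
      rw [closedDegree_dupDelStep_of_ne G hne, copiedVertex_castSucc, if_neg hvw, add_zero, ht]
      split_ifs <;> rfl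
  rw [Finset.sum_congr rfl fun v _ => hterm v, Finset.sum_add_distrib,
    sum_ite_mem_eq_card_mul_add, Finset.sum_ite_eq' Finset.univ w, if_pos (Finset.mem_univ w),
    ← closedDegree, Fintype.card_fin, ht]
  split_ifs <;> simp only [Nat.add_sub_cancel, add_zero] <;> ring

lemma sum_closedDegree_dupDelStep_last (φ : ℕ → ℝ) (u : Fin n) :
    ∑ v, φ (closedDegree (dupDelStep G u v) (Fin.last n)) =
      closedDegree G u * φ (closedDegree G u) +
        (n - closedDegree G u) * φ (closedDegree G u + 1) := by
  classical
  have hterm : ∀ v, φ (closedDegree (dupDelStep G u v) (Fin.last n)) =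
      if v ∈ closedNeighborFinset G u then φ (closedDegree G u) else φ (closedDegree G u + 1) := by
    intro v
    rw [closedDegree_dupDelStep_of_ne G (Fin.castSucc_ne_last v).symm, copiedVertex_last,
      if_pos (self_mem_closedNeighborFinset G u)]
    split_ifs <;> rfl
  rw [Finset.sum_congr rfl fun v _ => hterm v, sum_ite_mem_eq_card_mul_add, ← closedDegree,
    Fintype.card_fin]

lemma sum_sum_sum_closedDegree_dupDelStep (φ : ℕ → ℝ) :
    ∑ u, ∑ v, ∑ x, φ (closedDegree (dupDelStep G u v) x) = n ^ 2 * φ 1 +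
      ∑ w, (((closedDegree G w : ℝ) ^ 2 + (n - closedDegree G w) ^ 2) * φ (closedDegree G w) +
        (n - closedDegree G w) * ((closedDegree G w - 1) * φ (closedDegree G w - 1) +
          (closedDegree G w + 1) * φ (closedDegree G w + 1))) := by
  classical
  have hsplit : ∀ u, ∑ v, ∑ x, φ (closedDegree (dupDelStep G u v) x) =
      ∑ w, ∑ v, φ (closedDegree (dupDelStep G u v) (Fin.castSucc w)) +
        ∑ v, φ (closedDegree (dupDelStep G u v) (Fin.last n)) := fun u => by
    rw [Finset.sum_comm, Fin.sum_univ_castSucc]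
  rw [Finset.sum_congr rfl fun u _ => hsplit u, Finset.sum_add_distrib, Finset.sum_comm,
    ← Finset.sum_add_distrib, sq, mul_assoc, ← nsmul_eq_mul, ← nsmul_eq_mul, ← Fin.sum_const,
    ← Finset.sum_add_distrib]
  refine Finset.sum_congr rfl fun w _ => ?_
  rw [Finset.sum_congr rfl fun u _ => sum_closedDegree_dupDelStep_castSucc G φ u w,
    Finset.sum_add_distrib, Fin.sum_const, sum_ite_mem_eq_card_mul_add,
    sum_closedDegree_dupDelStep_last, ← closedDegree, Fintype.card_fin]
  ring

lemma sum_sum_vertexProfile_dupDelStep (k : ℕ) :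
    ∑ u, ∑ v, (vertexProfile (dupDelStep G u v) (k + 1) : ℝ) =
      ((k + 1) ^ 2 + (n - (k + 1)) ^ 2) * vertexProfile G (k + 1) +
        (k + 1) * ((n - (k + 2)) * vertexProfile G (k + 2) + (n - k) * vertexProfile G k) := by
  have hpred : ∀ w, (if closedDegree G w - 1 = k + 1 then (1 : ℝ) else 0) =
      if closedDegree G w = k + 2 then 1 else 0 := fun w => by
    have := closedDegree_pos G w
    exact if_congr (by omega) rfl rfl
  have hbirth : (n : ℝ) ^ 2 * (if 1 = k + 1 then 1 else 0) +
      ∑ w, (n - closedDegree G w) * (closedDegree G w + 1) *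
        (if closedDegree G w + 1 = k + 1 then (1 : ℝ) else 0) =
      (k + 1) * ((n - k) * vertexProfile G k) := by
    cases k with
    | zero =>
      simp [vertexProfile, (closedDegree_pos G _).ne', sq]
    | succ k =>
      have := sum_mul_ite_closedDegree_eq G (fun s => (n - s) * (s + 1)) k
      rw [if_neg (by omega), mul_zero, zero_add]
      simp only [Nat.add_right_cancel_iff, this]
      push_cast
      ring
  have hsame := sum_mul_ite_closedDegree_eq G (fun s => (s : ℝ) ^ 2 + (n - s) ^ 2) k
  have hdeath := sum_mul_ite_closedDegree_eq G (fun s => ((n : ℝ) - s) * (s - 1)) (k + 1)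
  simp only [vertexProfile_succ_eq_sum (dupDelStep G _ _),
    sum_sum_sum_closedDegree_dupDelStep G fun s => if s = k + 1 then 1 else 0, hpred, mul_add,
    ← mul_assoc, Finset.sum_add_distrib] at hbirth hsame hdeath ⊢
  push_cast at hsame hdeath
  linarith

/-- The mean of `vertexProfile` at `k` after one step from `G`. -/
noncomputable def meanVertexProfile {n : ℕ} (G : SimpleGraph (Fin n)) (k : ℕ) : ℝ :=
  𝔼 p : Fin n × Fin n, (vertexProfile (dupDelStep G p.1 p.2) k : ℝ)

lemma meanVertexProfile_succ_eq [NeZero n] (k : ℕ) :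
    meanVertexProfile G (k + 1) = vertexProfile G (k + 1) +
      (k + 1) * (vertexProfile G k + vertexProfile G (k + 2) - 2 * vertexProfile G (k + 1)) / n +
      (2 * (k + 1) ^ 2 * vertexProfile G (k + 1) -
        (k + 1) * ((k + 2) * vertexProfile G (k + 2) + k * vertexProfile G k)) / n ^ 2 := by
  have hn : (n : ℝ) ≠ 0 := Nat.cast_ne_zero.2 (NeZero.ne n)
  rw [meanVertexProfile, Fintype.expect_eq_sum_div_card, Fintype.sum_prod_type,
    sum_sum_vertexProfile_dupDelStep, Fintype.card_prod, Fintype.card_fin]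
  push_cast
  field_simp
  ring

lemma abs_meanVertexProfile_succ_sub_le [NeZero n] (k : ℕ) :
    |meanVertexProfile G (k + 1) - vertexProfile G (k + 1) -
      (k + 1) * (vertexProfile G k + vertexProfile G (k + 2) - 2 * vertexProfile G (k + 1)) / n| ≤
      2 * (k + 1) ^ 2 / n := by
  have hn : (0 : ℝ) < n := Nat.cast_pos.2 (NeZero.pos n)
  have hle : ∀ j, vertexProfile G j ≤ n := fun j =>
    (vertexProfile_le_card G j).trans_eq (Fintype.card_fin n)
  have hsame : 2 * ((k : ℝ) + 1) ^ 2 * vertexProfile G (k + 1) ≤ 2 * (k + 1) ^ 2 * n := by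
    gcongr
    exact hle _
  have hother : ((k : ℝ) + 1) * ((k + 2) * vertexProfile G (k + 2) + k * vertexProfile G k) ≤
      2 * (k + 1) ^ 2 * n := by
    calc
      _ ≤ ((k : ℝ) + 1) * ((k + 2) * n + k * n) := by gcongr <;> exact hle _
      _ = 2 * (k + 1) ^ 2 * n := by ring
  rw [meanVertexProfile_succ_eq, add_assoc, add_sub_cancel_left, add_sub_cancel_left, abs_div,
    abs_of_pos (pow_pos hn 2), div_le_div_iff₀ (pow_pos hn 2) hn, sq (n : ℝ), ← mul_assoc]
  gcongr
  exact abs_sub_le_of_nonneg_of_le (by positivity) hsame (by positivity) hother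

end Drift

section BoundedDifferences

lemma abs_card_sub_card_le {α : Type*} {S T D : Finset α} (h : ∀ x ∉ D, x ∈ S ↔ x ∈ T) :
    |(S.card : ℝ) - T.card| ≤ D.card := by
  classical
  have hST : S ⊆ T ∪ D := fun x hx => by grind
  have hTS : T ⊆ S ∪ D := fun x hx => by grind
  have hS := (Finset.card_le_card hST).trans (Finset.card_union_le T D)
  have hT := (Finset.card_le_card hTS).trans (Finset.card_union_le S D)
  rw [abs_sub_le_iff, sub_le_iff_le_add', sub_le_iff_le_add']
  exact ⟨mod_cast hS, mod_cast hT⟩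

variable {n : ℕ} {G : SimpleGraph (Fin n)}

namespace IsDisjointUnionOfCliques

variable (hG : IsDisjointUnionOfCliques G)
include hG

-- Apart from `v` and the new vertex, only the cliques of `u` and `v` change, each by at most one
-- vertex, so that only those with at most `k + 2` vertices matter.
lemma abs_vertexProfile_dupDelStep_sub_le (u v : Fin n) (k : ℕ) :
    |(vertexProfile (dupDelStep G u v) (k + 1) : ℝ) - vertexProfile G (k + 1)| ≤ 2 * k + 6 := by
  classical
  let A (a : Fin n) : Finset (Fin n) := {w ∈ closedNeighborFinset G a | closedDegree G w ≤ k + 2}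
  let D := insert v.castSucc (insert (Fin.last n) ((A u ∪ A v).map Fin.castSuccEmb))
  have hD : D.card ≤ 2 * k + 6 := calc
    D.card ≤ (A u ∪ A v).card + 1 + 1 := by
      refine (Finset.card_insert_le _ _).trans (Nat.add_le_add_right ?_ 1)
      exact (Finset.card_insert_le _ _).trans_eq (by rw [Finset.card_map])
    _ ≤ (k + 2) + (k + 2) + 1 + 1 := by
      gcongr
      exact (Finset.card_union_le _ _).trans (Nat.add_le_add
        (hG.card_filter_closedDegree_le u _) (hG.card_filter_closedDegree_le v _))
    _ = 2 * k + 6 := by ring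
  have hagree : ∀ x ∉ D, x ∈ ({x | closedDegree (dupDelStep G u v) x = k + 1} : Finset _) ↔
      x ∈ ({w | closedDegree G w = k + 1} : Finset _).map Fin.castSuccEmb := by
    intro x hx
    cases x using Fin.lastCases with
    | last => simp [D] at hx
    | cast w =>
      have hdeg := closedDegree_dupDelStep_add G (x := w.castSucc) (v := v) u (by grind)
      simp only [D, A, Finset.mem_insert, Finset.mem_map, Finset.mem_union, Finset.mem_filter,
        Fin.coe_castSuccEmb, Fin.castSucc_inj, exists_eq_right, not_or, not_and, not_le,
        mem_closedNeighborFinset_comm (b := w)] at hx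
      rw [copiedVertex_castSucc] at hdeg
      simp only [Finset.mem_filter_univ, Finset.mem_map, Fin.coe_castSuccEmb, Fin.castSucc_inj,
        exists_eq_right]
      split_ifs at hdeg <;> grind
  have hcard := abs_card_sub_card_le hagree
  rw [Finset.card_map] at hcard
  exact hcard.trans (mod_cast hD)

lemma abs_meanVertexProfile_sub_le [NeZero n] (k : ℕ) :
    |meanVertexProfile G (k + 1) - vertexProfile G (k + 1)| ≤ 2 * k + 6 := by
  rw [meanVertexProfile, ← Fintype.expect_const (ι := Fin n × Fin n) (vertexProfile G (k + 1) : ℝ),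
    ← Finset.expect_sub_distrib]
  exact (Finset.abs_expect_le _ _).trans (Finset.expect_le Finset.univ_nonempty fun p _ =>
    hG.abs_vertexProfile_dupDelStep_sub_le p.1 p.2 k)

end IsDisjointUnionOfCliques

end BoundedDifferences

section Noise

/-- The deviation from its mean of `vertexProfile` at `k + 1` after one step from `G`, when `p` is
the pair of selected vertices. -/
noncomputable def stepNoise {n : ℕ} (G : SimpleGraph (Fin n)) (k : ℕ) (p : Fin n × Fin n) : ℝ :=
  vertexProfile (dupDelStep G p.1 p.2) (k + 1) - meanVertexProfile G (k + 1)

lemma expect_stepNoise {n : ℕ} [NeZero n] (G : SimpleGraph (Fin n)) (k : ℕ) :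
    𝔼 p, stepNoise G k p = 0 := by
  simp_rw [stepNoise]
  rw [Finset.expect_sub_distrib, Fintype.expect_const, meanVertexProfile, sub_self]

lemma IsDisjointUnionOfCliques.abs_stepNoise_le {n : ℕ} [NeZero n] {G : SimpleGraph (Fin n)}
    (hG : IsDisjointUnionOfCliques G) (k : ℕ) (p : Fin n × Fin n) :
    |stepNoise G k p| ≤ 4 * k + 12 := by
  rw [stepNoise, ← sub_sub_sub_cancel_right _ _ (vertexProfile G (k + 1) : ℝ)]
  refine (abs_sub _ _).trans ?_
  linarith [hG.abs_vertexProfile_dupDelStep_sub_le p.1 p.2 k, hG.abs_meanVertexProfile_sub_le k]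

/-- The noise in step `n + 1` of the random process with selections `C`. -/
noncomputable def processNoise {Ω : Type*} (C : (n : ℕ) → Fin 2 → Ω → Fin (n + 1)) (k n : ℕ)
    (ω : Ω) : ℝ :=
  stepNoise (dupDelGraph (fun n i => C n i ω) n) k (C n 0 ω, C n 1 ω)

lemma abs_processNoise_le {Ω : Type*} (C : (n : ℕ) → Fin 2 → Ω → Fin (n + 1)) (k n : ℕ) (ω : Ω) :
    |processNoise C k n ω| ≤ 4 * k + 12 :=
  (isDisjointUnionOfCliques_dupDelGraph _ n).abs_stepNoise_le k _

lemma measurable_processNoise {Ω : Type*} {C : (n : ℕ) → Fin 2 → Ω → Fin (n + 1)} {n j : ℕ}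
    (k : ℕ) (hnj : n < j) : Measurable[selectionSigma C {p | p.1 < j}] (processNoise C k n) :=
  (measurable_from_top (f := fun G => (vertexProfile G (k + 1) : ℝ)).comp
    (measurable_dupDelGraph (m := n + 1) hnj)).sub
    ((measurable_from_top (f := fun G => meanVertexProfile G (k + 1))).comp
      (measurable_dupDelGraph hnj.le))

namespace IsUniformSelection

variable {Ω : Type*} [MeasurableSpace Ω] {μ : Measure Ω} [IsProbabilityMeasure μ]
  {C : (n : ℕ) → Fin 2 → Ω → Fin (n + 1)} (hC : IsUniformSelection μ C)
include hC

lemma memLp_processNoise (k n : ℕ) : MemLp (processNoise C k n) 2 μ := by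
  have hmeas : Measurable (processNoise C k n) :=
    (measurable_processNoise k n.lt_succ_self).mono (hC.selectionSigma_le _) le_rfl
  exact .of_bound hmeas.aestronglyMeasurable (4 * k + 12)
    (.of_forall fun ω => abs_processNoise_le C k n ω)

lemma integral_processNoise_mul_of_lt (k : ℕ) {i j : ℕ} (hij : i < j) :
    ∫ ω, processNoise C k i ω * processNoise C k j ω ∂μ = 0 := by
  let X : Ω → ℝ × SimpleGraph (Fin (j + 1)) := fun ω =>
    (processNoise C k i ω, dupDelGraph (fun n i => C n i ω) j)
  have hX : Measurable[selectionSigma C {p | p.1 < j}] X :=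
    (measurable_processNoise k hij).prodMk (measurable_dupDelGraph le_rfl)
  have hnoise : Measurable fun q : SimpleGraph (Fin (j + 1)) × (Fin (j + 1) × Fin (j + 1)) =>
      stepNoise q.1 k q.2 := .of_discrete
  have hprod : Measurable
      fun q : (ℝ × SimpleGraph (Fin (j + 1))) × (Fin (j + 1) × Fin (j + 1)) =>
        q.1.1 * stepNoise q.1.2 k q.2 := by fun_prop
  refine integral_comp_eq_zero_of_indepFun
    (hX.mono (hC.selectionSigma_le _) le_rfl).aemeasurable (hC.measurable_pair j).aemeasurable
    (hC.indepFun_pair hX) hprod fun x => ?_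
  change ∫ ω, x.1 * stepNoise x.2 k (C j 0 ω, C j 1 ω) ∂μ = 0
  rw [integral_const_mul, hC.integral_pair (stepNoise x.2 k), expect_stepNoise, mul_zero]

lemma ae_tendsto_sum_processNoise_div (k : ℕ) :
    ∀ᵐ ω ∂μ, Tendsto (fun n : ℕ => (∑ m ∈ Finset.range n, processNoise C k m ω) / n) atTop
      (𝓝 0) := by
  have hsq : ∀ n, ∫ ω, processNoise C k n ω ^ 2 ∂μ ≤ (4 * k + 12) ^ 2 := fun n => by
    refine (integral_mono (hC.memLp_processNoise k n).integrable_sq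
      (integrable_const ((4 * k + 12 : ℝ) ^ 2)) fun ω => ?_).trans_eq (by simp)
    exact sq_le_sq.2 ((abs_processNoise_le C k n ω).trans (le_abs_self _))
  refine ae_tendsto_sum_div_of_orthogonal (hC.memLp_processNoise k) hsq (B := 4 * k + 12)
    (fun n => .of_forall fun ω => (abs_le.1 (abs_processNoise_le C k n ω)).1) fun i j hij => ?_
  rcases hij.lt_or_gt with hlt | hlt
  · exact hC.integral_processNoise_mul_of_lt k hlt
  · simp_rw [mul_comm (processNoise C k i _)]
    exact hC.integral_processNoise_mul_of_lt k hlt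

end IsUniformSelection

end Noise

section LimitProfile

variable (c : (n : ℕ) → Fin 2 → Fin (n + 1))

/-- The error made in step `n + 1` by replacing the mean change of `vertexProfile` at `k + 1` by
its diffusive main term. -/
noncomputable def driftError (k n : ℕ) : ℝ :=
  meanVertexProfile (dupDelGraph c n) (k + 1) - vertexProfile (dupDelGraph c n) (k + 1) -
    (k + 1) * (vertexProfile (dupDelGraph c n) k + vertexProfile (dupDelGraph c n) (k + 2) -
      2 * vertexProfile (dupDelGraph c n) (k + 1)) / (n + 1)

lemma tendsto_sum_driftError_div (k : ℕ) :
    Tendsto (fun n : ℕ => (∑ m ∈ Finset.range n, driftError c k m) / n) atTop (𝓝 0) := by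
  have hle : ∀ n, |driftError c k n| ≤ 2 * (k + 1) ^ 2 / ((n + 1 : ℕ) : ℝ) := fun n => by
    simpa only [driftError, Nat.cast_succ] using
      abs_meanVertexProfile_succ_sub_le (dupDelGraph c n) k
  have hzero : Tendsto (driftError c k) atTop (𝓝 0) :=
    squeeze_zero_norm hle ((tendsto_const_div_atTop_nhds_zero_nat _).comp (tendsto_add_atTop_nat 1))
  simpa only [div_eq_inv_mul] using hzero.cesaro

lemma tendsto_vertexProfile_div
    (hnoise : ∀ k, Tendsto (fun n : ℕ =>
      (∑ m ∈ Finset.range n, stepNoise (dupDelGraph c m) k (c m 0, c m 1)) / n) atTop (𝓝 0))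
    (k : ℕ) :
    Tendsto (fun n : ℕ => (vertexProfile (dupDelGraph c n) k : ℝ) / (n + 1)) atTop
      (𝓝 (limitProfile k)) := by
  let X (k n : ℕ) : ℝ := vertexProfile (dupDelGraph c n) k
  let d (k n : ℕ) : ℝ := X k n - (n + 1) * limitProfile k
  have hd0 : ∀ n, d 0 n = 0 := fun n => by
    simp [d, X, vertexProfile, limitProfile_zero]
  have hB : ∀ k n, |d k n| ≤ 1 * ((n : ℝ) + 1) := fun k n => by
    have hX : X k n ≤ n + 1 := by
      simpa using Nat.cast_le (α := ℝ).2 (vertexProfile_le_card (dupDelGraph c n) k)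
    rw [one_mul]
    refine abs_sub_le_of_nonneg_of_le (Nat.cast_nonneg _) hX
      (mul_nonneg (by positivity) (limitProfile_pos k).le)
      (mul_le_of_le_one_right (by positivity) (limitProfile_le_one k))
  have hd : ∀ k n, d (k + 1) (n + 1) = d (k + 1) n +
      ((k : ℝ) + 1) * (d k n + d (k + 2) n - 2 * d (k + 1) n) / (n + 1) +
      (stepNoise (dupDelGraph c n) k (c n 0, c n 1) + driftError c k n) := fun k n => by
    simp only [d, X, stepNoise, driftError, dupDelGraph]
    push_cast
    field_simp
    linear_combination -((n : ℝ) + 1) * limitProfile_succ k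
  have hlim := tendsto_div_zero_of_diffusive_recursion (fun k => by positivity) hB (by simp [hd0])
    hd (fun k => by
      simpa only [Finset.sum_add_distrib, add_div, add_zero] using
        (hnoise k).add (tendsto_sum_driftError_div c k)) k
  have hX : ∀ n : ℕ, d k n / ((n : ℝ) + 1) + limitProfile k = X k n / (n + 1) := fun n => by
    have : (n : ℝ) + 1 ≠ 0 := by positivity
    simp only [d]
    field_simp
    ring
  simpa only [hX, zero_add] using hlim.add_const (limitProfile k)

end LimitProfile

section CliqueDensity

/-- The limit of the number of cliques of size `k`, divided by the number of steps. -/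
noncomputable def cliqueDensity (k : ℕ) : ℝ :=
  limitProfile k / k

lemma cliqueDensity_pos {k : ℕ} (hk : 1 ≤ k) : 0 < cliqueDensity k :=
  div_pos (limitProfile_pos k) (Nat.cast_pos.2 hk)

lemma cliqueDensity_one : cliqueDensity 1 = (1 + 2 * cliqueDensity 2) / 3 := by
  have h := limitProfile_succ 0
  rw [limitProfile_zero] at h
  norm_num [cliqueDensity] at h ⊢
  linarith

lemma cliqueDensity_eq {k : ℕ} (hk : 2 ≤ k) :
    cliqueDensity k = (((k : ℝ) - 1) * cliqueDensity (k - 1) +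
      ((k : ℝ) + 1) * cliqueDensity (k + 1)) / (2 * (k : ℝ) + 1) := by
  obtain ⟨k, rfl⟩ := Nat.exists_eq_add_of_le' hk
  have h := limitProfile_succ (k + 1)
  simp only [cliqueDensity, Nat.add_succ_sub_one]
  push_cast at h ⊢
  field_simp
  linear_combination ((k : ℝ) + 1) * h

lemma tendsto_numCliques_div (c : (n : ℕ) → Fin 2 → Fin (n + 1)) {k : ℕ} (hk : 1 ≤ k)
    (hprofile : Tendsto (fun n : ℕ => (vertexProfile (dupDelGraph c n) k : ℝ) / (n + 1)) atTop
      (𝓝 (limitProfile k))) :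
    Tendsto (fun n : ℕ => (numCliques (dupDelGraph c n) k : ℝ) / n) atTop
      (𝓝 (cliqueDensity k)) := by
  have hk0 : (k : ℝ) ≠ 0 := Nat.cast_ne_zero.2 (Nat.one_le_iff_ne_zero.1 hk)
  have hlim := (hprofile.div_const (k : ℝ)).mul
    ((tendsto_natCast_div_add_atTop (1 : ℝ)).inv₀ one_ne_zero)
  rw [inv_one, mul_one] at hlim
  refine hlim.congr' ?_
  filter_upwards [eventually_ne_atTop 0] with n hn
  have hn0 : (n : ℝ) ≠ 0 := Nat.cast_ne_zero.2 hn
  rw [(isDisjointUnionOfCliques_dupDelGraph c n).vertexProfile_eq hk]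
  push_cast
  field_simp

end CliqueDensity

theorem mainTheorem2 :
    ∃ y : ℕ → ℝ,
      (∀ k : ℕ, 1 ≤ k → 0 < y k) ∧
      y 1 = (1 + 2 * y 2) / 3 ∧
      (∀ k : ℕ, 2 ≤ k →
        y k = (((k : ℝ) - 1) * y (k - 1) + ((k : ℝ) + 1) * y (k + 1)) / (2 * (k : ℝ) + 1)) ∧
      ∀ (Ω : Type*) [MeasurableSpace Ω] (μ : Measure Ω) [IsProbabilityMeasure μ]
        (C : (n : ℕ) → Fin 2 → Ω → Fin (n + 1)), IsUniformSelection μ C →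
        (∀ (ω : Ω) (n : ℕ), IsDisjointUnionOfCliques (dupDelGraph (fun m i => C m i ω) n)) ∧
        ∀ k : ℕ, 1 ≤ k → ∀ᵐ ω ∂μ,
          Tendsto (fun n : ℕ => (numCliques (dupDelGraph (fun m i => C m i ω) n) k : ℝ) / (n : ℝ))
            atTop (𝓝 (y k)) := by
  refine ⟨cliqueDensity, fun _ => cliqueDensity_pos, cliqueDensity_one,
    fun _ => cliqueDensity_eq, fun Ω _ μ _ C hC =>
      ⟨fun ω => isDisjointUnionOfCliques_dupDelGraph _, fun k hk => ?_⟩⟩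
  filter_upwards [ae_all_iff.2 hC.ae_tendsto_sum_processNoise_div] with ω hnoise
  exact tendsto_numCliques_div _ hk (tendsto_vertexProfile_div _ hnoise k)
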